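/- Let $\theta\in(0,1)$, let $x>0$ be real, let $n\ge 0$ be an integer, and put $Y_n=\pi(n+\theta)x$. Let $$J_\nu(z)=\sum_{k=0}^{\infty}\frac{(-1)^k}{k!\,\Gamma(k+\nu+1)}\left(\frac z2\right)^{\nu+2k}$$ be the Bessel function of the first kind, let $\mathrm{ber}(t)=\mathrm{Re}\,J_0\!\left(te^{3\pi i/4}\right)$ for real $t$ be the Kelvin function, and let $\mathrm{ber}^{(1)}=\frac{d}{dt}\mathrm{ber}$ be its derivative. Then the integral below converges absolutely, the series below converges (as the limit of its partial sums $\sum_{m=1}^{M}$ as $M\to\infty$), and $$\sum_{m=1}^{\infty}\frac{J_1\!\left(4\pi\sqrt{m(n+\theta)x}\right)}{\sqrt{m(n+\theta)}}=\sqrt{x}\left(-\pi+\frac{1}{2Y_n}-\frac{2\sqrt{2}}{Y_n}\int_0^\infty\frac{\mathrm{ber}^{(1)}(2\sqrt{2}\,t)}{e^{t^2/Y_n}-1}\,dt\right).$$ -/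

import Mathlib

open Filter Topology MeasureTheory

/-- The Bessel function of the first kind of order `ν`,
`J_ν(z) = ∑_{k ≥ 0} (-1)^k / (k! Γ(k + ν + 1)) (z / 2)^(ν + 2k)`. The series converges absolutely;
at a pole of `Γ` Mathlib's `Complex.Gamma` is `0`, so that `1 / Γ` is `0` there, as it should be.
For a non-integral order the power is the principal one. -/
noncomputable def besselJ (ν z : ℂ) : ℂ :=
  ∑' k : ℕ, (-1) ^ k / ((k.factorial : ℂ) * Complex.Gamma (k + ν + 1)) * (z / 2) ^ (ν + 2 * k)

/-- The Kelvin function `ber_ν(x) = Re (J_ν(x e^{3πi/4}))` of a real variable. -/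
noncomputable def kelvinBer (ν x : ℝ) : ℝ :=
  (besselJ ν (x * Complex.exp (3 * Real.pi * Complex.I / 4))).re

/-- The derivative `ber^{(1)}(x) = d/dx ber(x)` of the Kelvin function `ber = ber_0`. -/
noncomputable def kelvinBerDeriv (x : ℝ) : ℝ :=
  deriv (fun y : ℝ => kelvinBer 0 y) x

/-! Each summand is `2π√x · C₁(cm)`, where `Cₙ` is `cliffordC n` and `c = 4πY`. This family is
closed under differentiation (`Cₙ' = -Cₙ₊₁`), so second-order Euler–Maclaurin applies to `t ↦
C₁(ct)` with every derivative explicit. Second order is needed because `C₁` decays only like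
`u^(-3/4)`, whereas `C₃` is integrable and the Fourier series of the periodized `B₂` converges
absolutely. Expanding that kernel reduces the remainder to the cosine transforms of `C₃`, which are
elementary (`fourier_three`, a boundary value of a Laplace transform). The outcome,
`tendsto_sum_one`, is `-1/2 + 1/c + (2/c) ∑ (1 - cos(2Y/k))`. The cosine sum becomes the Kelvin
integral in `hasSum_one_sub_cos`: `1 - cos(2Y/k)` is twice the Laplace transform of `Im C₁(-2iu)` at
`k/Y`, and summing the exponentials over `k` produces `1/(e^(u/Y) - 1)`. Substituting `u = t²` turns
`Im C₁` into `ber'`. -/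

/-- The Bessel–Clifford function `∑ (-z)^k / (k! (k + n)!)`, that is `J_n(2√z) / √z ^ n`. -/
noncomputable def cliffordC {𝕜 : Type*} [RCLike 𝕜] (n : ℕ) (z : 𝕜) : 𝕜 :=
  ∑' k : ℕ, (-z) ^ k / ((k.factorial : 𝕜) * ((k + n).factorial : 𝕜))

/-! ### Bessel–Clifford functions: series, derivative, recurrence -/

namespace cliffordC

variable {𝕜 : Type*} [RCLike 𝕜]

lemma norm_term_le (n k : ℕ) (z : 𝕜) :
    ‖(-z) ^ k / ((k.factorial : 𝕜) * ((k + n).factorial : 𝕜))‖ ≤ ‖z‖ ^ k / k.factorial := by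
  have h1 : (1 : ℝ) ≤ (k + n).factorial := by exact_mod_cast (k + n).factorial_pos
  have h2 : (0 : ℝ) < k.factorial := by exact_mod_cast k.factorial_pos
  rw [norm_div, norm_mul, norm_pow, norm_neg, RCLike.norm_natCast, RCLike.norm_natCast]
  gcongr
  nlinarith

lemma summable (n : ℕ) (z : 𝕜) :
    Summable fun k : ℕ => (-z) ^ k / ((k.factorial : 𝕜) * ((k + n).factorial : 𝕜)) :=
  Summable.of_norm_bounded (Real.summable_pow_div_factorial ‖z‖) fun k => norm_term_le n k z

lemma hasSum (n : ℕ) (z : 𝕜) :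
    HasSum (fun k : ℕ => (-z) ^ k / ((k.factorial : 𝕜) * ((k + n).factorial : 𝕜)))
      (cliffordC n z) :=
  (summable n z).hasSum

lemma ofReal (n : ℕ) (u : ℝ) : cliffordC n (u : ℂ) = (cliffordC n u : ℝ) := by
  unfold cliffordC
  rw [Complex.ofReal_tsum]
  push_cast
  rfl

lemma zero (n : ℕ) : cliffordC n (0 : 𝕜) = 1 / (n.factorial : 𝕜) := by
  unfold cliffordC
  rw [tsum_eq_single 0]
  · simp
  · intro k hk
    simp [hk]

lemma hasDerivAt (n : ℕ) (z : 𝕜) :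
    HasDerivAt (cliffordC n : 𝕜 → 𝕜) (-cliffordC (n + 1) z) z := by
  set R : ℝ := ‖z‖ + 1
  have hR : 0 ≤ R := by positivity
  have hu : Summable fun k : ℕ => (k : ℝ) * R ^ (k - 1) / k.factorial := by
    rw [← summable_nat_add_iff 1]
    refine (Real.summable_pow_div_factorial R).congr fun k => ?_
    rw [Nat.factorial_succ]
    push_cast
    field_simp
  have key := hasDerivAt_tsum_of_isPreconnected
    (g := fun (k : ℕ) (w : 𝕜) => (-w) ^ k / ((k.factorial : 𝕜) * ((k + n).factorial : 𝕜)))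
    (g' := fun (k : ℕ) (w : 𝕜) =>
      (k * (-w) ^ (k - 1) * (-1)) / ((k.factorial : 𝕜) * ((k + n).factorial : 𝕜)))
    (t := Metric.ball (0 : 𝕜) R) (y₀ := z) (y := z) hu Metric.isOpen_ball
    (convex_ball (0 : 𝕜) R).isPreconnected ?_ ?_ (by simp [R]) (summable n z) (by simp [R])
  · refine key.congr_deriv ?_
    have hs : Summable fun k : ℕ =>
        (k * (-z) ^ (k - 1) * (-1)) / ((k.factorial : 𝕜) * ((k + n).factorial : 𝕜)) := by
      rw [← summable_nat_add_iff 1]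
      refine (summable (n + 1) z).neg.congr fun k => ?_
      have h0 : ((k + 1 : ℕ) : 𝕜) ≠ 0 := by exact_mod_cast k.succ_ne_zero
      rw [Nat.factorial_succ, Nat.add_sub_cancel, show k + 1 + n = k + (n + 1) by ring]
      push_cast at *
      field_simp
    rw [hs.tsum_eq_zero_add]
    simp only [Nat.cast_zero, zero_mul, zero_div, zero_add]
    unfold cliffordC
    rw [← tsum_neg]
    refine tsum_congr fun k => ?_
    have h0 : ((k + 1 : ℕ) : 𝕜) ≠ 0 := by exact_mod_cast k.succ_ne_zero
    rw [Nat.factorial_succ, Nat.add_sub_cancel, show k + 1 + n = k + (n + 1) by ring]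
    push_cast at *
    field_simp
  · intro k w _
    exact ((hasDerivAt_neg w).pow k).div_const _
  · intro k w hw
    have hw' : ‖w‖ ≤ R := by simpa using (mem_ball_zero_iff.mp hw).le
    have h1 : (1 : ℝ) ≤ (k + n).factorial := by exact_mod_cast (k + n).factorial_pos
    have h2 : (0 : ℝ) < k.factorial := by exact_mod_cast k.factorial_pos
    simp only [norm_div, norm_mul, norm_pow, norm_neg, RCLike.norm_natCast, norm_one, mul_one]
    gcongr
    nlinarith

lemma continuous (n : ℕ) : Continuous (cliffordC n : 𝕜 → 𝕜) :=
  continuous_iff_continuousAt.mpr fun z => (hasDerivAt n z).continuousAt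

lemma mul_add_two (n : ℕ) (z : 𝕜) :
    z * cliffordC (n + 2) z = (n + 1) * cliffordC (n + 1) z - cliffordC n z := by
  have h1 := ((hasSum (n + 1) z).mul_left ((n : 𝕜) + 1)).sub (hasSum n z)
  rw [← hasSum_nat_add_iff' 1] at h1
  have h2 := (hasSum (n + 2) z).mul_left z
  have e : ((n + 1 : ℕ) : 𝕜) ≠ 0 := by exact_mod_cast n.succ_ne_zero
  -- The constant terms cancel, since `(n+1)/(n+1)! = 1/n!`; the remaining series then carries a
  -- factor `z`.
  have h4 : ((n : 𝕜) + 1) * cliffordC (n + 1) z - cliffordC n z -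
      ∑ k ∈ Finset.range 1, (((n : 𝕜) + 1) * ((-z) ^ k / ((k.factorial : 𝕜) *
        ((k + (n + 1)).factorial : 𝕜))) - (-z) ^ k / ((k.factorial : 𝕜) *
        ((k + n).factorial : 𝕜))) = (n + 1) * cliffordC (n + 1) z - cliffordC n z := by
    simp only [Finset.range_one, Finset.sum_singleton, zero_add, Nat.factorial_succ]
    push_cast at *
    field_simp
    simp
  rw [h4] at h1
  refine h2.unique (h1.congr_fun fun k => ?_)
  have h0 : ((k + 1 : ℕ) : 𝕜) ≠ 0 := by exact_mod_cast k.succ_ne_zero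
  have h3 : ((k + n + 2 : ℕ) : 𝕜) ≠ 0 := by exact_mod_cast (k + n + 1).succ_ne_zero
  rw [Nat.factorial_succ k, show k + 1 + (n + 1) = (k + n + 1) + 1 by ring,
    show k + 1 + n = k + n + 1 by ring, show k + (n + 2) = (k + n + 1) + 1 by ring,
    Nat.factorial_succ (k + n + 1)]
  push_cast at *
  have h3' : (k : 𝕜) + n + 1 + 1 ≠ 0 := by convert h3 using 1; ring
  field_simp
  ring

/-! ### Bounds and decay on the positive half-line -/

/-- The left side is the energy `J₀² + J₁²` at `2√u`. By the recurrence its derivative is `-C₁²`, so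
it decreases from its value 1 at 0. -/
lemma sq_add_mul_sq_le_one {u : ℝ} (hu : 0 ≤ u) :
    cliffordC 0 u ^ 2 + u * cliffordC 1 u ^ 2 ≤ 1 := by
  have hd : ∀ v : ℝ, HasDerivAt (fun v => cliffordC 0 v ^ 2 + v * cliffordC 1 v ^ 2)
      (-cliffordC 1 v ^ 2) v := by
    intro v
    have h := ((hasDerivAt 0 v).pow 2).add ((hasDerivAt_id v).mul ((hasDerivAt 1 v).pow 2))
    refine h.congr_deriv ?_
    have := mul_add_two 0 v
    simp at *
    linear_combination -2 * cliffordC 1 v * this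
  have hanti : Antitone fun v : ℝ => cliffordC 0 v ^ 2 + v * cliffordC 1 v ^ 2 :=
    antitone_of_hasDerivAt_nonpos hd fun v => neg_nonpos.mpr (sq_nonneg _)
  have := hanti hu
  simpa [zero] using this

lemma abs_zero_le {u : ℝ} (hu : 0 ≤ u) : |cliffordC 0 u| ≤ 1 := by
  rw [← sq_le_one_iff_abs_le_one]
  nlinarith [sq_add_mul_sq_le_one hu, mul_nonneg hu (sq_nonneg (cliffordC 1 u))]

lemma sqrt_mul_abs_one_le {u : ℝ} (hu : 0 ≤ u) : √u * |cliffordC 1 u| ≤ 1 := by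
  rw [← abs_of_nonneg (Real.sqrt_nonneg u), ← abs_mul, ← sq_le_one_iff_abs_le_one, mul_pow,
    Real.sq_sqrt hu]
  nlinarith [sq_add_mul_sq_le_one hu, sq_nonneg (cliffordC 0 u)]

lemma abs_two_le {u : ℝ} (hu : 1 ≤ u) : |cliffordC 2 u| ≤ 2 / u := by
  have h0 := abs_zero_le (zero_le_one.trans hu)
  have h1 := sqrt_mul_abs_one_le (zero_le_one.trans hu)
  have h2 : 1 ≤ √u := Real.one_le_sqrt.mpr hu
  have h3 := mul_add_two 0 u
  have h4 : |cliffordC 1 u| ≤ 1 := by nlinarith [abs_nonneg (cliffordC 1 u)]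
  rw [le_div_iff₀ (by linarith), mul_comm, ← abs_of_nonneg (zero_le_one.trans hu), ← abs_mul,
    abs_of_nonneg (zero_le_one.trans hu), h3]
  simp only [Nat.cast_zero, zero_add, one_mul]
  exact (abs_sub _ _).trans (by linarith)

/-- The recurrence gives `u|C₃| ≤ 2|C₂| + |C₁|`, and both terms on the right are `O(u^(-1/2))`. The
exponent is not sharp, but it makes `C₃` integrable. -/
lemma abs_three_le {u : ℝ} (hu : 1 ≤ u) : |cliffordC 3 u| ≤ 5 * u ^ (-(3 / 2) : ℝ) := by
  have hu0 : 0 < u := by linarith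
  have h1 := sqrt_mul_abs_one_le hu0.le
  have h2 := abs_two_le hu
  have hs : 1 ≤ √u := Real.one_le_sqrt.mpr hu
  have hss : √u * √u = u := Real.mul_self_sqrt hu0.le
  have h3 := mul_add_two 1 u
  have e : u ^ (-(3 / 2) : ℝ) = 1 / (u * √u) := by
    rw [Real.rpow_neg hu0.le, show (3 / 2 : ℝ) = 1 + 1 / 2 by norm_num, Real.rpow_add hu0,
      Real.rpow_one, ← Real.sqrt_eq_rpow, one_div]
  rw [e, mul_one_div, le_div_iff₀ (by positivity)]
  have h4 : |cliffordC 3 u| * u ≤ 2 * |cliffordC 2 u| + |cliffordC 1 u| := by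
    rw [mul_comm, ← abs_of_pos hu0, ← abs_mul, abs_of_pos hu0, h3]
    refine (abs_sub _ _).trans ?_
    rw [abs_mul]
    norm_num
  rw [le_div_iff₀ hu0] at h2
  have h5 : √u * |cliffordC 2 u| ≤ 2 := by
    nlinarith [abs_nonneg (cliffordC 2 u)]
  nlinarith

lemma tendsto_one : Tendsto (cliffordC 1 : ℝ → ℝ) atTop (𝓝 0) := by
  rw [tendsto_zero_iff_abs_tendsto_zero]
  refine squeeze_zero' (Eventually.of_forall fun _ => abs_nonneg _) ?_
    (tendsto_inv_atTop_zero.comp Real.tendsto_sqrt_atTop)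
  filter_upwards [eventually_gt_atTop 0] with u hu
  have := sqrt_mul_abs_one_le hu.le
  have hs := Real.sqrt_pos.mpr hu
  simp only [Function.comp]
  rw [inv_eq_one_div, le_div_iff₀ hs]
  linarith

lemma tendsto_two : Tendsto (cliffordC 2 : ℝ → ℝ) atTop (𝓝 0) := by
  rw [tendsto_zero_iff_abs_tendsto_zero]
  refine squeeze_zero' (Eventually.of_forall fun _ => abs_nonneg _) ?_
    (tendsto_const_nhds (x := (2 : ℝ)).div_atTop tendsto_id)
  filter_upwards [eventually_ge_atTop 1] with u hu
  exact abs_two_le hu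

/-- The energy bound alone leaves `C₀` merely bounded, and this estimate supplies its decay. The
logarithmic loss is harmless. -/
lemma sqrt_mul_zero_sq_le {u : ℝ} (hu : 1 ≤ u) :
    √u * cliffordC 0 u ^ 2 ≤ 4 + Real.log u / 4 := by
  -- The cross term `-C₀C₁/2` cancels the leading part of the derivative of `√v` times the energy.
  -- What is left, `C₀C₁/(4√v)`, is at most `1/(4v)`, and the logarithm absorbs it.
  set F : ℝ → ℝ := fun v => √v * (cliffordC 0 v ^ 2 + v * cliffordC 1 v ^ 2
    - cliffordC 0 v * cliffordC 1 v / 2) - Real.log v / 4 with hF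
  have hd : ∀ v : ℝ, 0 < v → HasDerivAt F
      (cliffordC 0 v * cliffordC 1 v / (4 * √v) - 1 / (4 * v)) v := by
    intro v hv
    have hs := Real.sqrt_pos.mpr hv
    have hE := (((hasDerivAt 0 v).pow 2).add ((hasDerivAt_id v).mul ((hasDerivAt 1 v).pow 2))).sub
      (((hasDerivAt 0 v).mul (hasDerivAt 1 v)).div_const 2)
    have h := ((Real.hasDerivAt_sqrt hv.ne').mul hE).sub ((Real.hasDerivAt_log hv.ne').div_const 4)
    refine h.congr_deriv ?_
    have h2 := mul_add_two 0 v
    have hss : √v ^ 2 = v := Real.sq_sqrt hv.le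
    simp only [Pi.pow_apply, Pi.mul_apply, Pi.add_apply, Pi.sub_apply, id] at *
    set s := √v
    have : cliffordC 2 v = (cliffordC 1 v - cliffordC 0 v) / v := by
      field_simp
      linear_combination h2
    simp only [zero_add, show 1 + 1 = 2 from rfl, this]
    rw [← hss]
    field_simp
    ring
  have hanti : AntitoneOn F (Set.Ici 1) := by
    refine antitoneOn_of_deriv_nonpos (convex_Ici 1) ?_ ?_ ?_
    · exact fun v hv => (hd v (by linarith [Set.mem_Ici.mp hv])).continuousAt.continuousWithinAt
    · rw [interior_Ici]
      exact fun v hv => (hd v (by linarith [Set.mem_Ioi.mp hv])).differentiableAt.differentiableWithinAt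
    · rw [interior_Ici]
      intro v hv
      have hv0 : 0 < v := by linarith [Set.mem_Ioi.mp hv]
      have hs := Real.sqrt_pos.mpr hv0
      have hss : √v * √v = v := Real.mul_self_sqrt hv0.le
      rw [(hd v hv0).deriv, sub_nonpos, div_le_div_iff₀ (by positivity) (by positivity)]
      have h1 := sqrt_mul_abs_one_le hv0.le
      have h0 := abs_zero_le hv0.le
      have h3 : cliffordC 0 v * (√v * cliffordC 1 v) ≤ 1 := by
        refine (le_abs_self _).trans ?_
        rw [abs_mul, abs_mul, abs_of_pos hs]
        exact mul_le_one₀ h0 (by positivity) h1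
      nlinarith
  have h := hanti (Set.mem_Ici.mpr le_rfl) (Set.mem_Ici.mpr hu) hu
  have hs : 1 ≤ √u := Real.one_le_sqrt.mpr hu
  have hbd : ∀ v : ℝ, 1 ≤ v → |√v * (cliffordC 0 v * cliffordC 1 v)| ≤ 1 := by
    intro v hv
    have hv0 : 0 < v := by linarith
    have e : √v * (cliffordC 0 v * cliffordC 1 v) = cliffordC 0 v * (√v * cliffordC 1 v) := by ring
    rw [e, abs_mul, abs_mul, abs_of_nonneg (Real.sqrt_nonneg v)]
    exact mul_le_one₀ (abs_zero_le hv0.le) (by positivity) (sqrt_mul_abs_one_le hv0.le)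
  have b1 := abs_le.mp (hbd 1 le_rfl)
  have bu := abs_le.mp (hbd u hu)
  have e1 := sq_add_mul_sq_le_one (zero_le_one (α := ℝ))
  simp only [hF, Real.sqrt_one, Real.log_one, one_mul] at h b1 e1
  have : 0 ≤ √u * (u * cliffordC 1 u ^ 2) := by positivity
  linarith

lemma tendsto_zero : Tendsto (cliffordC 0 : ℝ → ℝ) atTop (𝓝 0) := by
  have hsq : Tendsto (fun u : ℝ => cliffordC 0 u ^ 2) atTop (𝓝 0) := by
    have hlim : Tendsto (fun u : ℝ => 4 * (√u)⁻¹ + (Real.log u / u ^ (1 / 2 : ℝ)) / 4) atTop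
        (𝓝 (4 * 0 + 0 / 4)) :=
      ((tendsto_inv_atTop_zero.comp Real.tendsto_sqrt_atTop).const_mul 4).add
        ((isLittleO_log_rpow_atTop (by norm_num)).tendsto_div_nhds_zero.div_const 4)
    rw [mul_zero, zero_div, add_zero] at hlim
    refine squeeze_zero' (Eventually.of_forall fun _ => sq_nonneg _) ?_ hlim
    filter_upwards [eventually_ge_atTop 1] with u hu
    have hs := Real.sqrt_pos.mpr (show (0 : ℝ) < u by linarith)
    have := sqrt_mul_zero_sq_le hu
    rw [← Real.sqrt_eq_rpow]
    have e : 4 * (√u)⁻¹ + Real.log u / √u / 4 = (4 + Real.log u / 4) / √u := by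
      field_simp
    rw [e, le_div_iff₀ hs]
    linarith
  have := hsq.sqrt
  simp only [Real.sqrt_sq_eq_abs, Real.sqrt_zero] at this
  exact (tendsto_zero_iff_abs_tendsto_zero _).mpr this

lemma integrableOn_three : IntegrableOn (cliffordC 3 : ℝ → ℝ) (Set.Ioi 0) := by
  rw [← Set.Ioc_union_Ioi_eq_Ioi (zero_le_one (α := ℝ))]
  refine IntegrableOn.union ?_ ?_
  · exact ((continuous 3).integrableOn_Icc).mono_set Set.Ioc_subset_Icc_self
  · refine Integrable.mono' (((integrableOn_Ioi_rpow_of_lt (a := -(3 / 2)) (by norm_num)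
      zero_lt_one).const_mul 5)) (continuous 3).aestronglyMeasurable ?_
    filter_upwards [ae_restrict_mem measurableSet_Ioi] with u hu
    exact abs_three_le (Set.mem_Ioi.mp hu).le

end cliffordC

/-! ### Laplace and Fourier transforms -/

lemma integrableOn_pow_mul_exp_neg_mul_Ioi (k : ℕ) {r : ℝ} (hr : 0 < r) :
    IntegrableOn (fun t : ℝ => t ^ k * Real.exp (-r * t)) (Set.Ioi 0) := by
  have h := integrableOn_rpow_mul_exp_neg_mul_rpow (p := 1) (s := k) (b := r)
    (by linarith [k.cast_nonneg (α := ℝ)]) one_pos hr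
  simpa using h

lemma norm_pow_mul_cexp (k : ℕ) (s : ℂ) {t : ℝ} (ht : 0 ≤ t) :
    ‖(t : ℂ) ^ k * Complex.exp (-s * t)‖ = t ^ k * Real.exp (-s.re * t) := by
  rw [norm_mul, norm_pow, Complex.norm_real, Real.norm_of_nonneg ht, Complex.norm_exp]
  simp

lemma integrableOn_pow_mul_cexp_neg_mul_Ioi (k : ℕ) {s : ℂ} (hs : 0 < s.re) :
    IntegrableOn (fun t : ℝ => (t : ℂ) ^ k * Complex.exp (-s * t)) (Set.Ioi 0) := by
  refine Integrable.mono' (integrableOn_pow_mul_exp_neg_mul_Ioi k hs)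
    (Continuous.aestronglyMeasurable (by fun_prop)) ?_
  filter_upwards [ae_restrict_mem measurableSet_Ioi] with t ht
  exact (norm_pow_mul_cexp k s (Set.mem_Ioi.mp ht).le).le

lemma integral_pow_mul_cexp_neg_mul_Ioi (k : ℕ) {s : ℂ} (hs : 0 < s.re) :
    ∫ t in Set.Ioi (0 : ℝ), (t : ℂ) ^ k * Complex.exp (-s * t) = k.factorial / s ^ (k + 1) := by
  have hs0 : s ≠ 0 := by
    rintro rfl
    simp at hs
  induction k with
  | zero =>
    have h := integral_exp_mul_complex_Ioi (a := -s) (by simpa using hs) 0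
    simp only [pow_zero, one_mul, h]
    simp
  | succ k ih =>
    have hd : ∀ t ∈ Set.Ici (0 : ℝ), HasDerivAt
        (fun t : ℝ => (t : ℂ) ^ (k + 1) * Complex.exp (-s * t))
        ((k + 1) * ((t : ℂ) ^ k * Complex.exp (-s * t))
          - s * ((t : ℂ) ^ (k + 1) * Complex.exp (-s * t))) t := by
      intro t _
      have h1 : HasDerivAt (fun z : ℂ => z ^ (k + 1) * Complex.exp (-s * z))
          ((k + 1) * ((t : ℂ) ^ k * Complex.exp (-s * t))
          - s * ((t : ℂ) ^ (k + 1) * Complex.exp (-s * t))) (t : ℂ) := by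
        refine ((hasDerivAt_pow (k + 1) (t : ℂ)).mul
          (((hasDerivAt_id (t : ℂ)).const_mul (-s)).cexp)).congr_deriv ?_
        simp
        ring
      exact h1.comp_ofReal
    have hlim : Tendsto (fun t : ℝ => (t : ℂ) ^ (k + 1) * Complex.exp (-s * t)) atTop (𝓝 0) := by
      rw [tendsto_zero_iff_norm_tendsto_zero]
      refine (tendsto_rpow_mul_exp_neg_mul_atTop_nhds_zero (k + 1 : ℕ) s.re hs).congr' ?_
      filter_upwards [eventually_ge_atTop 0] with t ht
      rw [norm_pow_mul_cexp _ _ ht, Real.rpow_natCast]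
    have i1 := (integrableOn_pow_mul_cexp_neg_mul_Ioi k hs).const_mul ((k : ℂ) + 1)
    have i2 := (integrableOn_pow_mul_cexp_neg_mul_Ioi (k + 1) hs).const_mul s
    have h := integral_Ioi_of_hasDerivAt_of_tendsto' hd (i1.sub i2) hlim
    rw [integral_sub i1 i2, integral_const_mul, integral_const_mul, ih] at h
    simp only [Complex.ofReal_zero, ne_eq, Nat.add_eq_zero_iff, one_ne_zero, and_false,
      not_false_eq_true, zero_pow, zero_mul, sub_zero, sub_eq_zero] at h
    have h' : ∫ t in Set.Ioi (0 : ℝ), (t : ℂ) ^ (k + 1) * Complex.exp (-s * t) =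
        (((k : ℂ) + 1) * (k.factorial / s ^ (k + 1))) / s := by
      rw [h]
      field_simp
    rw [h', Nat.factorial_succ]
    push_cast
    field_simp
    ring

lemma integral_pow_mul_exp_neg_mul_Ioi (k : ℕ) {r : ℝ} (hr : 0 < r) :
    ∫ t in Set.Ioi (0 : ℝ), t ^ k * Real.exp (-r * t) = k.factorial / r ^ (k + 1) := by
  have h := integral_pow_mul_cexp_neg_mul_Ioi k (s := r) (by simpa using hr)
  have e : ∀ t : ℝ, (t : ℂ) ^ k * Complex.exp (-r * t) = ((t ^ k * Real.exp (-r * t) : ℝ) : ℂ) := by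
    intro t
    push_cast
    rfl
  simp only [e] at h
  rw [integral_complex_ofReal] at h
  exact_mod_cast h

lemma Complex.hasSum_exp_tail (n : ℕ) (w : ℂ) :
    HasSum (fun j : ℕ => w ^ (j + n) / (j + n).factorial)
      (Complex.exp w - ∑ i ∈ Finset.range n, w ^ i / i.factorial) := by
  have h := NormedSpace.expSeries_div_hasSum_exp (𝔸 := ℂ) w
  rw [← Complex.exp_eq_exp_ℂ] at h
  exact (hasSum_nat_add_iff' n).mpr h

namespace cliffordC

/-- Integrating `t^j` cancels one of the two factorials, so the transformed series is still of
exponential type. Termwise integration is therefore legitimate for every `Re s > 0`, whatever the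
size of `z`. -/
lemma hasSum_laplace (n : ℕ) (z : ℂ) {s : ℂ} (hs : 0 < s.re) :
    HasSum (fun j : ℕ => (-z) ^ j / ((j + n).factorial * s ^ (j + 1)))
      (∫ t in Set.Ioi (0 : ℝ), cliffordC n (z * t) * Complex.exp (-s * t)) := by
  set F : ℕ → ℝ → ℂ := fun j t => ((-z) ^ j / (j.factorial * (j + n).factorial)) *
    ((t : ℂ) ^ j * Complex.exp (-s * t)) with hF
  have hint : ∀ j, Integrable (F j) (volume.restrict (Set.Ioi 0)) := fun j =>
    (integrableOn_pow_mul_cexp_neg_mul_Ioi j hs).const_mul _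
  have hnorm : ∀ j, ∫ t in Set.Ioi (0 : ℝ), ‖F j t‖ ≤ s.re⁻¹ * ((‖z‖ / s.re) ^ j / j.factorial) := by
    intro j
    have e : ∫ t in Set.Ioi (0 : ℝ), ‖F j t‖ = ∫ t in Set.Ioi (0 : ℝ),
        (‖z‖ ^ j / (j.factorial * (j + n).factorial)) * (t ^ j * Real.exp (-s.re * t)) := by
      refine setIntegral_congr_fun measurableSet_Ioi fun t ht => ?_
      simp only [hF]
      rw [norm_mul, norm_pow_mul_cexp _ _ (Set.mem_Ioi.mp ht).le]
      simp
    rw [e, integral_const_mul, integral_pow_mul_exp_neg_mul_Ioi j hs]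
    have h1 : (j.factorial : ℝ) ≤ (j + n).factorial := by
      exact_mod_cast Nat.factorial_le (Nat.le_add_right j n)
    have h2 : (0 : ℝ) < j.factorial := by exact_mod_cast j.factorial_pos
    have h3 : ‖z‖ ^ j / (j.factorial * (j + n).factorial) * (j.factorial / s.re ^ (j + 1)) =
        s.re⁻¹ * ((‖z‖ / s.re) ^ j / (j + n).factorial) := by
      have h4 : (0 : ℝ) < (j + n).factorial := by linarith
      rw [div_pow]
      field_simp
      ring
    rw [h3]
    gcongr
  have hsum : Summable fun j => ∫ t in Set.Ioi (0 : ℝ), ‖F j t‖ :=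
    Summable.of_nonneg_of_le (fun j => integral_nonneg fun t => norm_nonneg _) hnorm
      ((Real.summable_pow_div_factorial _).mul_left _)
  have key := hasSum_integral_of_summable_integral_norm hint hsum
  have e1 : ∀ t : ℝ, ∑' j, F j t = cliffordC n (z * t) * Complex.exp (-s * t) := by
    intro t
    rw [← ((hasSum n (z * t)).mul_right (Complex.exp (-s * t))).tsum_eq]
    refine tsum_congr fun j => ?_
    simp only [hF, ← neg_mul, mul_pow]
    ring
  simp only [e1] at key
  refine key.congr_fun fun j => ?_
  simp only [hF]
  rw [integral_const_mul, integral_pow_mul_cexp_neg_mul_Ioi j hs]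
  have h2 : (j.factorial : ℂ) ≠ 0 := by exact_mod_cast j.factorial_ne_zero
  have h3 : ((j + n).factorial : ℂ) ≠ 0 := by exact_mod_cast (j + n).factorial_ne_zero
  have hs0 : s ≠ 0 := by
    rintro rfl
    simp at hs
  field_simp

lemma laplace_one {z : ℂ} (hz : z ≠ 0) {s : ℂ} (hs : 0 < s.re) :
    ∫ t in Set.Ioi (0 : ℝ), cliffordC 1 (z * t) * Complex.exp (-s * t) =
      (1 - Complex.exp (-z / s)) / z := by
  have hs0 : s ≠ 0 := by
    rintro rfl
    simp at hs
  have h := (Complex.hasSum_exp_tail 1 (-z / s)).mul_left (-z⁻¹)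
  refine ((hasSum_laplace 1 z hs).unique (h.congr_fun fun j => ?_)).trans ?_
  · rw [div_pow, pow_succ (-z)]
    field_simp
  · simp
    field_simp
    ring

lemma laplace_three {s : ℂ} (hs : 0 < s.re) :
    ∫ t in Set.Ioi (0 : ℝ), cliffordC 3 (t : ℂ) * Complex.exp (-s * t) =
      s ^ 2 * (1 - Complex.exp (-1 / s)) - s + 1 / 2 := by
  have hs0 : s ≠ 0 := by
    rintro rfl
    simp at hs
  have h := (Complex.hasSum_exp_tail 3 (-1 / s)).mul_left (-s ^ 2)
  have h1 := hasSum_laplace 3 1 hs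
  simp only [one_mul] at h1
  refine (h1.unique (h.congr_fun fun j => ?_)).trans ?_
  · rw [div_pow, pow_add (-1 : ℂ) j 3, pow_add s j 3, pow_succ s j]
    field_simp
  · simp [Finset.sum_range_succ, Nat.factorial]
    field_simp
    ring

/-- Real part of `laplace_three` at `s = σ + iω` as `σ → 0⁺`; integrability of `C₃` provides the
domination. -/
lemma fourier_three {ω : ℝ} (hω : 0 < ω) :
    ∫ t in Set.Ioi (0 : ℝ), cliffordC 3 t * Real.cos (ω * t) =
      1 / 2 - ω ^ 2 * (1 - Real.cos (1 / ω)) := by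
  set F : ℂ → ℂ := fun s => s ^ 2 * (1 - Complex.exp (-1 / s)) - s + 1 / 2 with hF
  have hω0 : (ω * Complex.I : ℂ) ≠ 0 := by
    simp [hω.ne']
  set σ : ℕ → ℝ := fun m => 1 / ((m : ℝ) + 1) with hσ
  have hσpos : ∀ m, 0 < σ m := fun m => Nat.one_div_pos_of_nat
  have hs : Tendsto (fun m => (σ m : ℂ) + ω * Complex.I) atTop (𝓝 (ω * Complex.I)) := by
    have : Tendsto (fun m => ((σ m : ℝ) : ℂ)) atTop (𝓝 ((0 : ℝ) : ℂ)) :=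
      (Complex.continuous_ofReal.tendsto 0).comp tendsto_one_div_add_atTop_nhds_zero_nat
    simpa using this.add_const (ω * Complex.I : ℂ)
  have hFc : ContinuousAt F (ω * Complex.I) := by
    simp only [hF]
    fun_prop (disch := assumption)
  have l1 := hFc.tendsto.comp hs
  have l2 : Tendsto (fun m => ∫ t in Set.Ioi (0 : ℝ),
      cliffordC 3 (t : ℂ) * Complex.exp (-((σ m : ℂ) + ω * Complex.I) * t)) atTop
      (𝓝 (∫ t in Set.Ioi (0 : ℝ), cliffordC 3 (t : ℂ) * Complex.exp (-(ω * Complex.I) * t))) := by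
    refine tendsto_integral_of_dominated_convergence (fun t => ‖cliffordC 3 t‖) ?_
      integrableOn_three.norm ?_ ?_
    · intro m
      refine Continuous.aestronglyMeasurable ?_
      exact ((continuous 3).comp Complex.continuous_ofReal).mul (by fun_prop)
    · intro m
      filter_upwards [ae_restrict_mem measurableSet_Ioi] with t ht
      have ht0 := Set.mem_Ioi.mp ht
      rw [norm_mul, ofReal, Complex.norm_real, Complex.norm_exp]
      refine mul_le_of_le_one_right (norm_nonneg _) (Real.exp_le_one_iff.mpr ?_)
      simp
      have := hσpos m
      positivity
    · refine Eventually.of_forall fun t => ?_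
      have : Continuous fun s : ℂ => cliffordC 3 (t : ℂ) * Complex.exp (-s * t) := by fun_prop
      exact (this.tendsto _).comp hs
  have e : ∀ m, ∫ t in Set.Ioi (0 : ℝ),
      cliffordC 3 (t : ℂ) * Complex.exp (-((σ m : ℂ) + ω * Complex.I) * t) =
      (F ∘ fun m => (σ m : ℂ) + ω * Complex.I) m := fun m =>
    laplace_three (by simpa using hσpos m)
  have h := tendsto_nhds_unique (l2.congr e) l1
  have hint : IntegrableOn
      (fun t : ℝ => cliffordC 3 (t : ℂ) * Complex.exp (-(ω * Complex.I) * t)) (Set.Ioi 0) := by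
    refine Integrable.mono' integrableOn_three.norm (Continuous.aestronglyMeasurable
      (((continuous 3).comp Complex.continuous_ofReal).mul (by fun_prop))) ?_
    refine Eventually.of_forall fun t => ?_
    rw [norm_mul, ofReal, Complex.norm_real, Complex.norm_exp]
    simp
  have hre := congrArg Complex.re h
  rw [← RCLike.re_eq_complex_re, ← integral_re hint] at hre
  have e2 : ∀ t : ℝ, RCLike.re (cliffordC 3 (t : ℂ) * Complex.exp (-(ω * Complex.I) * t)) =
      cliffordC 3 t * Real.cos (ω * t) := by
    intro t
    rw [ofReal, RCLike.re_eq_complex_re, Complex.re_ofReal_mul,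
      show -(ω * Complex.I) * (t : ℂ) = ((-(ω * t) : ℝ) : ℂ) * Complex.I by push_cast; ring,
      Complex.exp_ofReal_mul_I_re, Real.cos_neg]
  simp only [e2] at hre
  rw [hre, hF]
  have e3 : (-1 / (ω * Complex.I) : ℂ) = ((1 / ω : ℝ) : ℂ) * Complex.I := by
    have : (ω : ℂ) ≠ 0 := by exact_mod_cast hω.ne'
    push_cast
    field_simp
    simp
  have e4 : (ω * Complex.I : ℂ) ^ 2 = ((-ω ^ 2 : ℝ) : ℂ) := by
    rw [mul_pow, Complex.I_sq]
    push_cast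
    ring
  simp only [e3, e4, RCLike.re_eq_complex_re, Complex.add_re, Complex.sub_re,
    Complex.re_ofReal_mul, Complex.exp_ofReal_mul_I_re]
  simp
  ring

end cliffordC

/-! ### Euler–Maclaurin summation with a Fourier-expanded remainder -/

/-- `π²` times the second periodized Bernoulli function, as a Fourier series. -/
noncomputable def bernoulliKernel (t : ℝ) : ℝ :=
  ∑' n : ℕ, 1 / (n : ℝ) ^ 2 * Real.cos (2 * Real.pi * n * t)

lemma norm_bernoulliKernel_term_le (n : ℕ) (t : ℝ) :
    ‖1 / (n : ℝ) ^ 2 * Real.cos (2 * Real.pi * n * t)‖ ≤ 1 / (n : ℝ) ^ 2 := by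
  rw [norm_mul, Real.norm_of_nonneg (by positivity)]
  exact mul_le_of_le_one_right (by positivity) (Real.abs_cos_le_one _)

lemma hasSum_bernoulliKernel (t : ℝ) :
    HasSum (fun n : ℕ => 1 / (n : ℝ) ^ 2 * Real.cos (2 * Real.pi * n * t)) (bernoulliKernel t) :=
  (hasSum_zeta_two.summable.of_norm_bounded fun n => norm_bernoulliKernel_term_le n t).hasSum

lemma continuous_bernoulliKernel : Continuous bernoulliKernel :=
  continuous_tsum (fun n => by fun_prop) hasSum_zeta_two.summable norm_bernoulliKernel_term_le

lemma norm_bernoulliKernel_le (t : ℝ) : ‖bernoulliKernel t‖ ≤ Real.pi ^ 2 / 6 :=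
  tsum_of_norm_bounded hasSum_zeta_two fun n => norm_bernoulliKernel_term_le n t

lemma bernoulliKernel_eq (m : ℕ) {t : ℝ} (ht : t ∈ Set.Icc (m : ℝ) (m + 1)) :
    bernoulliKernel t = Real.pi ^ 2 * ((t - m) ^ 2 - (t - m) + 1 / 6) := by
  have h := hasSum_one_div_nat_pow_mul_cos one_ne_zero (x := t - m)
    ⟨by linarith [ht.1], by linarith [ht.2]⟩
  refine (hasSum_bernoulliKernel t).unique ?_
  have e : (-1 : ℝ) ^ (1 + 1) * (2 * Real.pi) ^ (2 * 1) / 2 / (2 * 1).factorial *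
      (Polynomial.map (algebraMap ℚ ℝ) (Polynomial.bernoulli (2 * 1))).eval (t - m) =
      Real.pi ^ 2 * ((t - m) ^ 2 - (t - m) + 1 / 6) := by
    have := bernoulliFun_two (t - m)
    unfold bernoulliFun at this
    rw [mul_one, this, Nat.factorial_two]
    push_cast
    ring
  rw [e] at h
  refine h.congr_fun fun n => ?_
  rw [mul_one, show 2 * Real.pi * n * (t - m) = 2 * Real.pi * n * t - (n * m : ℕ) * (2 * Real.pi) by
    push_cast; ring, Real.cos_sub_nat_mul_two_pi]

lemma sum_Icc_eq_of_hasDerivAt {A f f' f'' : ℝ → ℝ} (hA : ∀ t, HasDerivAt A (f t) t)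
    (hf : ∀ t, HasDerivAt f (f' t) t) (hf' : ∀ t, HasDerivAt f' (f'' t) t)
    (hc : Continuous f'') (M : ℕ) :
    ∑ m ∈ Finset.Icc 1 M, f m = (f' M - f' 0) / 12 + (f M - f 0) / 2 + (A M - A 0)
      - 1 / (2 * Real.pi ^ 2) * ∫ t in (0 : ℝ)..M, bernoulliKernel t * f'' t := by
  have hcont : Continuous fun t => bernoulliKernel t * f'' t := continuous_bernoulliKernel.mul hc
  induction M with
  | zero => simp
  | succ m ih =>
    rw [Finset.sum_Icc_succ_top (by omega), ih, Nat.cast_succ,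
      ← intervalIntegral.integral_add_adjacent_intervals (hcont.intervalIntegrable 0 m)
        (hcont.intervalIntegrable m (m + 1))]
    have e : ∫ t in (m : ℝ)..(m + 1), bernoulliKernel t * f'' t =
        ∫ t in (m : ℝ)..(m + 1), Real.pi ^ 2 * (((t - m) ^ 2 - (t - m) + 1 / 6) * f'' t) := by
      refine intervalIntegral.integral_congr fun t ht => ?_
      rw [Set.uIcc_of_le (by linarith)] at ht
      simp only [bernoulliKernel_eq m ht]
      ring
    -- Two integrations by parts packed into one antiderivative, `B₂f' - B₂'f + 2A`, using `B₂'' =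
    -- 2`.
    have hd : ∀ t ∈ Set.uIcc (m : ℝ) (m + 1), HasDerivAt
        (fun t => ((t - m) ^ 2 - (t - m) + 1 / 6) * f' t - (2 * (t - m) - 1) * f t + 2 * A t)
        (((t - m) ^ 2 - (t - m) + 1 / 6) * f'' t) t := by
      intro t _
      have h1 := (hasDerivAt_id t).sub_const (m : ℝ)
      have h2 := ((((h1.pow 2).sub h1).add_const (1 / 6)).mul (hf' t)).sub
        ((((h1.const_mul 2).sub_const 1)).mul (hf t)) |>.add ((hA t).const_mul 2)
      refine h2.congr_deriv ?_
      simp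
      ring
    rw [e, intervalIntegral.integral_const_mul, intervalIntegral.integral_eq_sub_of_hasDerivAt hd
      (Continuous.intervalIntegrable (by fun_prop) _ _)]
    have := Real.pi_ne_zero
    field_simp
    ring

/-- The boundary terms at infinity vanish. The kernel series and the integral may be exchanged
because `|f''|/n²` dominates. -/
lemma tendsto_sum_of_hasSum_fourier {A f f' f'' : ℝ → ℝ} (hA : ∀ t, HasDerivAt A (f t) t)
    (hf : ∀ t, HasDerivAt f (f' t) t) (hf' : ∀ t, HasDerivAt f' (f'' t) t)
    (hc : Continuous f'') (hint : IntegrableOn f'' (Set.Ioi 0))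
    (lA : Tendsto A atTop (𝓝 0)) (lf : Tendsto f atTop (𝓝 0)) (lf' : Tendsto f' atTop (𝓝 0))
    {S : ℝ} (hS : HasSum (fun n : ℕ => 1 / (n : ℝ) ^ 2 *
      ∫ t in Set.Ioi (0 : ℝ), f'' t * Real.cos (2 * Real.pi * n * t)) S) :
    Tendsto (fun M : ℕ => ∑ m ∈ Finset.Icc 1 M, f m) atTop
      (𝓝 (-f' 0 / 12 - f 0 / 2 - A 0 - 1 / (2 * Real.pi ^ 2) * S)) := by
  have h1 : HasSum (fun n : ℕ => ∫ t in Set.Ioi (0 : ℝ),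
      (1 / (n : ℝ) ^ 2 * Real.cos (2 * Real.pi * n * t)) * f'' t)
      (∫ t in Set.Ioi (0 : ℝ), bernoulliKernel t * f'' t) := by
    refine hasSum_integral_of_dominated_convergence (fun n t => 1 / (n : ℝ) ^ 2 * ‖f'' t‖)
      (fun n => Continuous.aestronglyMeasurable (by fun_prop)) (fun n => Eventually.of_forall
        fun t => ?_) (Eventually.of_forall fun t => hasSum_zeta_two.summable.mul_right _) ?_
      (Eventually.of_forall fun t => (hasSum_bernoulliKernel t).mul_right _)
    · rw [norm_mul]
      gcongr
      exact norm_bernoulliKernel_term_le n t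
    · simp only [tsum_mul_right]
      exact hint.norm.const_mul _
  have h2 : ∫ t in Set.Ioi (0 : ℝ), bernoulliKernel t * f'' t = S := by
    refine h1.unique (hS.congr_fun fun n => ?_)
    rw [← integral_const_mul]
    refine integral_congr_ae (Eventually.of_forall fun t => ?_)
    ring
  have hK : IntegrableOn (fun t => bernoulliKernel t * f'' t) (Set.Ioi 0) :=
    Integrable.bdd_mul hint continuous_bernoulliKernel.aestronglyMeasurable
      (Eventually.of_forall norm_bernoulliKernel_le)
  have hM : Tendsto (fun M : ℕ => (M : ℝ)) atTop atTop := tendsto_natCast_atTop_atTop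
  have l := intervalIntegral_tendsto_integral_Ioi 0 hK hM
  rw [h2] at l
  have l' := ((((lf'.comp hM).sub_const (f' 0)).div_const 12).add
    (((lf.comp hM).sub_const (f 0)).div_const 2)).add ((lA.comp hM).sub_const (A 0)) |>.sub
    (l.const_mul (1 / (2 * Real.pi ^ 2)))
  convert l' using 1
  · ext M
    exact sum_Icc_eq_of_hasDerivAt hA hf hf' hc M
  · congr 1
    ring

/-! ### The sum of `C₁(cm)` as a cosine series -/

namespace cliffordC

lemma tendsto_sum_one {c : ℝ} (hc : 0 < c) {D : ℝ}
    (hD : HasSum (fun n : ℕ => 1 - Real.cos (c / (2 * Real.pi * n))) D) :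
    Tendsto (fun M : ℕ => ∑ m ∈ Finset.Icc 1 M, cliffordC 1 (c * (m : ℝ))) atTop
      (𝓝 (-1 / 2 + 1 / c + 2 / c * D)) := by
  have hcd : ∀ (n : ℕ) (t : ℝ), HasDerivAt (fun t : ℝ => cliffordC n (c * t))
      (-c * cliffordC (n + 1) (c * t)) t := by
    intro n t
    have := (hasDerivAt n (c * t)).comp t ((hasDerivAt_id t).const_mul c)
    refine this.congr_deriv ?_
    ring
  have hlim : Tendsto (fun t : ℝ => c * t) atTop atTop := tendsto_id.const_mul_atTop hc
  have hS : HasSum (fun n : ℕ => 1 / (n : ℝ) ^ 2 *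
      ∫ t in Set.Ioi (0 : ℝ), c ^ 2 * cliffordC 3 (c * t) * Real.cos (2 * Real.pi * n * t))
      (c / 2 * (Real.pi ^ 2 / 6) - 4 * Real.pi ^ 2 / c * D) := by
    refine ((hasSum_zeta_two.mul_left (c / 2)).sub
      (hD.mul_left (4 * Real.pi ^ 2 / c))).congr_fun fun n => ?_
    -- Division by zero being 0, the index-0 terms all vanish: `1/0² = 0` and `1 - cos 0 = 0`.
    rcases Nat.eq_zero_or_pos n with rfl | hn
    · simp
    have hn' : (0 : ℝ) < n := by exact_mod_cast hn
    have hpi := Real.pi_pos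
    have hω : 0 < 2 * Real.pi * n / c := by positivity
    have e : ∀ t : ℝ, c ^ 2 * cliffordC 3 (c * t) * Real.cos (2 * Real.pi * n * t) =
        c ^ 2 * (fun u => cliffordC 3 u * Real.cos (2 * Real.pi * n / c * u)) (c * t) := by
      intro t
      have : 2 * Real.pi * n / c * (c * t) = 2 * Real.pi * n * t := by field_simp
      simp only [this]
      ring
    simp only [e]
    rw [integral_const_mul, integral_comp_mul_left_Ioi
      (fun u => cliffordC 3 u * Real.cos (2 * Real.pi * n / c * u)) 0 hc, mul_zero, fourier_three hω,
      smul_eq_mul, one_div_div]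
    field_simp
    ring
  have h := tendsto_sum_of_hasSum_fourier
    (A := fun t => -(cliffordC 0 (c * t) / c)) (f := fun t => cliffordC 1 (c * t))
    (f' := fun t => -c * cliffordC 2 (c * t)) (f'' := fun t => c ^ 2 * cliffordC 3 (c * t))
    (fun t => ((hcd 0 t).div_const c).neg.congr_deriv (by field_simp))
    (fun t => hcd 1 t) (fun t => ((hcd 2 t).const_mul (-c)).congr_deriv (by ring))
    (continuous_const.mul ((continuous 3).comp (by fun_prop)))
    (Integrable.const_mul ((integrableOn_Ioi_comp_mul_left_iff (cliffordC 3) 0 hc).mpr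
      (by simpa using integrableOn_three)) (c ^ 2))
    (by simpa using ((tendsto_zero.comp hlim).div_const c).neg)
    (tendsto_one.comp hlim) (by simpa using (tendsto_two.comp hlim).const_mul (-c)) hS
  -- The boundary contribution `c/24` from `f'(0)` cancels the `ζ(2)` part of the remainder.
  convert h using 2
  simp only [mul_zero, zero]
  have := Real.pi_ne_zero
  norm_num [Nat.factorial]
  field_simp
  ring

end cliffordC

/-! ### From the cosine series to an integral -/

namespace cliffordC

/-- Growth slower than any exponential: `|z|^k/k!²` factors as `(1/δ)^k/k!` times `(δ|z|)^k/k!`,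
with the first factor at most `e^(1/δ)`. -/
lemma norm_le_exp {𝕜 : Type*} [RCLike 𝕜] (n : ℕ) (z : 𝕜) {δ : ℝ} (hδ : 0 < δ) :
    ‖cliffordC n z‖ ≤ Real.exp (1 / δ) * Real.exp (δ * ‖z‖) := by
  have h := (NormedSpace.expSeries_div_hasSum_exp (𝔸 := ℝ) (δ * ‖z‖)).mul_left (Real.exp (1 / δ))
  rw [← Real.exp_eq_exp_ℝ] at h
  refine tsum_of_norm_bounded h fun k => ?_
  have h1 := Real.pow_div_factorial_le_exp (1 / δ) (by positivity) k
  have h2 : (k.factorial : ℝ) ≤ (k + n).factorial := by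
    exact_mod_cast Nat.factorial_le (Nat.le_add_right k n)
  have h3 : (0 : ℝ) < k.factorial := by exact_mod_cast k.factorial_pos
  rw [norm_div, norm_mul, norm_pow, norm_neg, RCLike.norm_natCast, RCLike.norm_natCast]
  calc ‖z‖ ^ k / (k.factorial * (k + n).factorial)
      ≤ ‖z‖ ^ k / (k.factorial * k.factorial) := by gcongr
    _ = (1 / δ) ^ k / k.factorial * ((δ * ‖z‖) ^ k / k.factorial) := by
      rw [mul_pow, one_div, inv_pow]
      field_simp
    _ ≤ Real.exp (1 / δ) * ((δ * ‖z‖) ^ k / k.factorial) := by gcongr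

/-- Since 1 is real, this gives `Im C₁(-2iu) = O(u)` near 0, which offsets the pole of `1/(e^(u/Y) -
1)`. -/
lemma norm_sub_one_le (z : ℂ) {δ : ℝ} (hδ : 0 < δ) :
    ‖cliffordC 1 z - 1‖ ≤ Real.exp (1 / δ) * Real.exp (δ * ‖z‖) * ‖z‖ := by
  have h := (convex_closedBall (0 : ℂ) ‖z‖).norm_image_sub_le_of_norm_hasDerivWithin_le
    (f := cliffordC 1) (f' := fun w => -cliffordC 2 w)
    (C := Real.exp (1 / δ) * Real.exp (δ * ‖z‖)) (x := 0) (y := z)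
    (fun w _ => (hasDerivAt 1 w).hasDerivWithinAt) (fun w hw => ?_) (by simp) (by simp)
  · simpa [zero] using h
  · rw [norm_neg]
    refine (norm_le_exp 2 w hδ).trans ?_
    gcongr
    simpa using hw

lemma integrableOn_mul_cexp (n : ℕ) (z : ℂ) {s : ℂ} (hs : 0 < s.re) :
    IntegrableOn (fun t : ℝ => cliffordC n (z * t) * Complex.exp (-s * t)) (Set.Ioi 0) := by
  -- Chosen so that the growth uses up at most half of the decay rate `Re s`; the `+ 1` covers `z =
  -- 0`.
  set δ : ℝ := s.re / (2 * (‖z‖ + 1)) with hδ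
  have hδ0 : 0 < δ := by positivity
  have hδz : δ * ‖z‖ ≤ s.re / 2 := by
    rw [hδ, div_mul_eq_mul_div, div_le_iff₀ (by positivity)]
    nlinarith [norm_nonneg z]
  have hint := (integrableOn_exp_mul_Ioi (a := -(s.re / 2)) (by linarith) 0).const_mul
    (Real.exp (1 / δ))
  refine Integrable.mono' hint (Continuous.aestronglyMeasurable
    (((continuous n).comp (by fun_prop)).mul (by fun_prop))) ?_
  filter_upwards [ae_restrict_mem measurableSet_Ioi] with t ht
  have ht0 : 0 < t := ht
  have h1 := norm_le_exp n (z * t) hδ0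
  have h2 : ‖Complex.exp (-s * t)‖ = Real.exp (-s.re * t) := by
    rw [Complex.norm_exp]
    simp
  rw [norm_mul, h2]
  refine (mul_le_mul_of_nonneg_right h1 (Real.exp_pos _).le).trans ?_
  rw [mul_assoc, ← Real.exp_add, norm_mul, Complex.norm_real, Real.norm_of_nonneg ht0.le]
  gcongr
  nlinarith

lemma integral_im_mul_exp {r : ℝ} (hr : 0 < r) :
    ∫ u in Set.Ioi (0 : ℝ), (cliffordC 1 (-2 * Complex.I * u)).im * Real.exp (-r * u) =
      (1 - Real.cos (2 / r)) / 2 := by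
  have hs : 0 < (r : ℂ).re := by simpa using hr
  have h := congrArg Complex.im (laplace_one (z := -2 * Complex.I) (by simp) hs)
  rw [← RCLike.im_eq_complex_im, ← integral_im (integrableOn_mul_cexp 1 _ hs)] at h
  have e : ∀ u : ℝ, RCLike.im (cliffordC 1 (-2 * Complex.I * u) * Complex.exp (-(r : ℂ) * u)) =
      (cliffordC 1 (-2 * Complex.I * u)).im * Real.exp (-r * u) := by
    intro u
    rw [show -(r : ℂ) * u = ((-r * u : ℝ) : ℂ) by push_cast; ring, ← Complex.ofReal_exp,
      RCLike.im_eq_complex_im, Complex.im_mul_ofReal]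
  simp only [e] at h
  rw [h]
  have e2 : (1 - Complex.exp (-(-2 * Complex.I) / r)) / (-2 * Complex.I) =
      ((1 / 2 : ℝ) : ℂ) * ((1 - Complex.exp ((2 / r : ℝ) * Complex.I)) * Complex.I) := by
    rw [show -(-2 * Complex.I) / (r : ℂ) = ((2 / r : ℝ) : ℂ) * Complex.I by push_cast; ring]
    field_simp
    push_cast
    ring_nf
    simp
  rw [e2, RCLike.im_eq_complex_im, Complex.im_ofReal_mul, Complex.mul_I_im, Complex.sub_re,
    Complex.exp_ofReal_mul_I_re, Complex.one_re]
  ring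

lemma abs_im_div_le {Y u : ℝ} (hY : 0 < Y) (hu : 0 < u) :
    |(cliffordC 1 (-2 * Complex.I * u)).im| / (Real.exp (u / Y) - 1) ≤
      2 * Y * Real.exp (8 * Y) * Real.exp (-(1 / (4 * Y)) * u) := by
  -- With this `δ` the numerator grows like `u·e^(u/(4Y))`, against the lower bound
  -- `(u/Y)·e^(u/(2Y))` for the denominator.
  have h1 := norm_sub_one_le (-2 * Complex.I * u) (δ := 1 / (8 * Y)) (by positivity)
  have h2 : |(cliffordC 1 (-2 * Complex.I * u)).im| ≤ ‖cliffordC 1 (-2 * Complex.I * u) - 1‖ := by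
    simpa using Complex.abs_im_le_norm (cliffordC 1 (-2 * Complex.I * u) - 1)
  have hn : ‖-2 * Complex.I * (u : ℂ)‖ = 2 * u := by
    simp [abs_of_pos hu]
  rw [hn, one_div_one_div] at h1
  -- This is `sinh v ≥ v` at `v = u/(2Y)`, multiplied by `2e^v`.
  have h3 : u / Y * Real.exp (u / (2 * Y)) ≤ Real.exp (u / Y) - 1 := by
    have hs := Real.self_le_sinh_iff.mpr (show 0 ≤ u / (2 * Y) by positivity)
    rw [Real.sinh_eq] at hs
    have e : Real.exp (u / Y) = Real.exp (u / (2 * Y)) * Real.exp (u / (2 * Y)) := by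
      rw [← Real.exp_add]
      congr 1
      field_simp
      ring
    have e' : Real.exp (u / (2 * Y)) * Real.exp (-(u / (2 * Y))) = 1 := by
      rw [← Real.exp_add]
      simp
    have e2 : u / Y = 2 * (u / (2 * Y)) := by field_simp
    rw [e]
    nlinarith [Real.exp_pos (u / (2 * Y))]
  have h4 : 0 < u / Y * Real.exp (u / (2 * Y)) := by positivity
  rw [div_le_iff₀ (h4.trans_le h3)]
  refine (h2.trans h1).trans ?_
  refine le_trans (le_of_eq ?_) (mul_le_mul_of_nonneg_left h3 (by positivity))
  have e : Real.exp (1 / (8 * Y) * (2 * u)) =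
      Real.exp (-(1 / (4 * Y)) * u) * Real.exp (u / (2 * Y)) := by
    rw [← Real.exp_add]
    congr 1
    field_simp
    ring
  rw [e]
  field_simp

lemma integrableOn_im_div {Y : ℝ} (hY : 0 < Y) :
    IntegrableOn (fun u : ℝ => (cliffordC 1 (-2 * Complex.I * u)).im / (Real.exp (u / Y) - 1))
      (Set.Ioi 0) := by
  have hc : Continuous fun u : ℝ => (cliffordC 1 (-2 * Complex.I * u)).im :=
    Complex.continuous_im.comp ((continuous 1).comp (by fun_prop))
  refine Integrable.mono' ((integrableOn_exp_mul_Ioi (a := -(1 / (4 * Y)))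
    (by simpa using hY) 0).const_mul (2 * Y * Real.exp (8 * Y)))
    (Measurable.aestronglyMeasurable (hc.measurable.div (by fun_prop))) ?_
  filter_upwards [ae_restrict_mem measurableSet_Ioi] with u hu
  have hu0 : 0 < u := hu
  have : 0 < Real.exp (u / Y) - 1 := sub_pos.mpr (Real.one_lt_exp_iff.mpr (by positivity))
  rw [norm_div, Real.norm_eq_abs, Real.norm_of_nonneg this.le]
  exact abs_im_div_le hY hu0

/-- Expand `1/(e^(u/Y) - 1)` as a geometric series and apply `integral_im_mul_exp` with `r =
(k+1)/Y`. The exponentials are positive, so the absolute values sum to the integrable function of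
`integrableOn_im_div`. -/
lemma hasSum_one_sub_cos {Y : ℝ} (hY : 0 < Y) :
    HasSum (fun n : ℕ => 1 - Real.cos (2 * Y / n))
      (2 * ∫ u in Set.Ioi (0 : ℝ),
        (cliffordC 1 (-2 * Complex.I * u)).im / (Real.exp (u / Y) - 1)) := by
  set g : ℝ → ℝ := fun u => (cliffordC 1 (-2 * Complex.I * u)).im with hg
  have hc : Continuous g := Complex.continuous_im.comp ((continuous 1).comp (by fun_prop))
  have hgeom : ∀ u ∈ Set.Ioi (0 : ℝ), HasSum (fun k : ℕ => Real.exp (-((k + 1) / Y) * u))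
      (1 / (Real.exp (u / Y) - 1)) := by
    intro u hu
    have hu0 : 0 < u := hu
    have h2 : 1 < Real.exp (u / Y) := Real.one_lt_exp_iff.mpr (by positivity)
    have h1 : Real.exp (-(u / Y)) < 1 := by
      rw [Real.exp_neg]
      exact inv_lt_one_of_one_lt₀ h2
    have h := (hasSum_geometric_of_lt_one (Real.exp_pos _).le h1).mul_left (Real.exp (-(u / Y)))
    have e : Real.exp (-(u / Y)) * (1 - Real.exp (-(u / Y)))⁻¹ = 1 / (Real.exp (u / Y) - 1) := by
      have h3 : Real.exp (u / Y) - 1 ≠ 0 := by linarith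
      rw [Real.exp_neg]
      field_simp
    rw [e] at h
    refine h.congr_fun fun k => ?_
    rw [← Real.exp_nat_mul, ← Real.exp_add]
    congr 1
    ring
  have key : HasSum (fun k : ℕ => ∫ u in Set.Ioi (0 : ℝ), g u * Real.exp (-((k + 1) / Y) * u))
      (∫ u in Set.Ioi (0 : ℝ), g u / (Real.exp (u / Y) - 1)) := by
    refine hasSum_integral_of_dominated_convergence
      (fun k u => ‖g u * Real.exp (-((k + 1) / Y) * u)‖)
      (fun k => Continuous.aestronglyMeasurable (by fun_prop))
      (fun k => Eventually.of_forall fun u => le_rfl) ?_ ?_ ?_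
    · filter_upwards [ae_restrict_mem measurableSet_Ioi] with u hu
      exact ((hgeom u hu).mul_left (g u)).summable.norm
    · refine ((integrableOn_im_div hY).norm).congr ?_
      filter_upwards [ae_restrict_mem measurableSet_Ioi] with u hu
      have hu0 : 0 < u := hu
      have h2 : 0 < Real.exp (u / Y) - 1 := sub_pos.mpr (Real.one_lt_exp_iff.mpr (by positivity))
      have e : ∀ k : ℕ, ‖g u * Real.exp (-((k + 1) / Y) * u)‖ =
          ‖g u‖ * Real.exp (-((k + 1) / Y) * u) := fun k => by
        rw [norm_mul, Real.norm_of_nonneg (Real.exp_pos _).le]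
      simp only [e]
      rw [tsum_mul_left, (hgeom u hu).tsum_eq, norm_div, Real.norm_of_nonneg h2.le, mul_one_div]
    · filter_upwards [ae_restrict_mem measurableSet_Ioi] with u hu
      rw [← mul_one_div]
      exact (hgeom u hu).mul_left (g u)
  rw [← hasSum_nat_add_iff' 1]
  simp only [Finset.range_one, Finset.sum_singleton, Nat.cast_zero, div_zero, Real.cos_zero,
    sub_self, sub_zero]
  refine (key.mul_left 2).congr_fun fun k => ?_
  have hk : (0 : ℝ) < (k + 1) / Y := by positivity
  rw [hg, integral_im_mul_exp hk]
  push_cast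
  rw [div_div_eq_mul_div]
  ring

end cliffordC

/-! ### Bessel and Kelvin functions; the final identity -/

lemma besselJ_natCast (n : ℕ) (z : ℂ) :
    besselJ n z = (z / 2) ^ n * cliffordC n (z ^ 2 / 4) := by
  unfold besselJ cliffordC
  rw [← tsum_mul_left]
  refine tsum_congr fun k => ?_
  rw [show (k : ℂ) + n + 1 = ((k + n : ℕ) : ℂ) + 1 by push_cast; ring,
    Complex.Gamma_nat_eq_factorial, show (n : ℂ) + 2 * k = ((n + 2 * k : ℕ) : ℂ) by push_cast; ring,
    Complex.cpow_natCast, pow_add, pow_mul, neg_pow (z ^ 2 / 4), div_pow z 2 2]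
  norm_num
  ring

lemma kelvinBer_zero (y : ℝ) :
    kelvinBer 0 y = (cliffordC 0 (-Complex.I * (y : ℂ) ^ 2 / 4)).re := by
  have h := besselJ_natCast 0 (y * Complex.exp (3 * Real.pi * Complex.I / 4))
  have e : Complex.exp (3 * Real.pi * Complex.I / 4) ^ 2 = -Complex.I := by
    rw [← Complex.exp_nat_mul, show ((2 : ℕ) : ℂ) * (3 * Real.pi * Complex.I / 4) =
      Real.pi * Complex.I + Real.pi / 2 * Complex.I by push_cast; ring, Complex.exp_add,
      Complex.exp_pi_mul_I, Complex.exp_pi_div_two_mul_I]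
    ring
  unfold kelvinBer
  rw [Nat.cast_zero] at h
  rw [Complex.ofReal_zero, h, mul_pow, e, pow_zero, one_mul, mul_comm ((y : ℂ) ^ 2)]

/-- Chain rule with `C₀' = -C₁`; the factor `i` from the argument `-iy²/4` turns the real part into
minus the imaginary part. -/
lemma kelvinBerDeriv_eq (y : ℝ) :
    kelvinBerDeriv y = -(y / 2) * (cliffordC 1 (-Complex.I * (y : ℂ) ^ 2 / 4)).im := by
  unfold kelvinBerDeriv
  simp only [kelvinBer_zero]
  have h : HasDerivAt (fun w : ℂ => cliffordC 0 (-Complex.I * w ^ 2 / 4))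
      (((y / 2 : ℝ) : ℂ) * (Complex.I * cliffordC 1 (-Complex.I * (y : ℂ) ^ 2 / 4))) (y : ℂ) := by
    have h1 := (((hasDerivAt_pow 2 (y : ℂ)).const_mul (-Complex.I)).div_const 4)
    refine ((cliffordC.hasDerivAt 0 _).comp (y : ℂ) h1).congr_deriv ?_
    push_cast
    ring
  rw [h.real_of_complex.deriv, Complex.re_ofReal_mul, Complex.I_mul_re]
  ring

theorem theorem2 (n : ℕ) (θ x : ℝ) (hθ0 : 0 < θ) (hθ1 : θ < 1) (hx : 0 < x)
    (Y : ℝ) (hY : Y = Real.pi * (n + θ) * x) :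
    IntegrableOn (fun t : ℝ => kelvinBerDeriv (2 * √2 * t) / (Real.exp (t ^ 2 / Y) - 1))
      (Set.Ioi 0) ∧
    Tendsto
      (fun M : ℕ => ∑ m ∈ Finset.Icc 1 M,
        besselJ 1 ((4 * Real.pi * √(m * (n + θ) * x) : ℝ) : ℂ) / ((√(m * (n + θ)) : ℝ) : ℂ))
      atTop
      (𝓝 ((√x * (-Real.pi + 1 / (2 * Y) - 2 * √2 / Y *
        ∫ t in Set.Ioi (0 : ℝ),
          kelvinBerDeriv (2 * √2 * t) / (Real.exp (t ^ 2 / Y) - 1)) : ℝ) : ℂ)) := by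
  have hpi := Real.pi_pos
  have hnθ : 0 < (n : ℝ) + θ := by positivity
  have hY0 : 0 < Y := by
    rw [hY]
    positivity
  have h2 : √2 ^ 2 = 2 := Real.sq_sqrt (by norm_num)
  set G : ℝ → ℝ := fun u => (cliffordC 1 (-2 * Complex.I * u)).im / (Real.exp (u / Y) - 1) with hG
  -- At `y = 2√2 t` the Clifford argument is `-2it²`. The right side is written with the Jacobian of
  -- `u = t²` in the form used by the change-of-variables lemmas.
  have hint : ∀ t : ℝ, kelvinBerDeriv (2 * √2 * t) / (Real.exp (t ^ 2 / Y) - 1) =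
      -(√2 / 2) * ((2 * t ^ ((2 : ℝ) - 1)) • G (t ^ (2 : ℝ))) := by
    intro t
    have e : -Complex.I * ((2 * √2 * t : ℝ) : ℂ) ^ 2 / 4 = -2 * Complex.I * ((t ^ 2 : ℝ) : ℂ) := by
      rw [← Complex.ofReal_pow, mul_pow, mul_pow, h2]
      push_cast
      ring
    rw [kelvinBerDeriv_eq, e]
    norm_num [hG]
    ring
  have hI : ∫ t in Set.Ioi (0 : ℝ), kelvinBerDeriv (2 * √2 * t) / (Real.exp (t ^ 2 / Y) - 1) =
      -(√2 / 2) * ∫ u in Set.Ioi (0 : ℝ), G u := by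
    simp only [hint]
    rw [integral_const_mul, integral_comp_rpow_Ioi_of_pos two_pos]
  refine ⟨?_, ?_⟩
  · simp only [hint]
    have h := (integrableOn_Ioi_comp_rpow_iff G (p := 2) two_ne_zero).mpr
      (cliffordC.integrableOn_im_div hY0)
    rw [abs_two] at h
    exact Integrable.const_mul h _
  · have hD : HasSum (fun k : ℕ => 1 - Real.cos (4 * Real.pi * Y / (2 * Real.pi * k)))
        (2 * ∫ u in Set.Ioi (0 : ℝ), G u) := by
      refine (cliffordC.hasSum_one_sub_cos hY0).congr_fun fun k => ?_
      rw [show 4 * Real.pi * Y / (2 * Real.pi * k) = 2 * Y / k by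
        rw [show 4 * Real.pi * Y = 2 * Real.pi * (2 * Y) by ring,
          mul_div_mul_left _ _ (by positivity)]]
    have l := (cliffordC.tendsto_sum_one (by positivity) hD).const_mul (2 * Real.pi * √x)
    have hterm : ∀ m : ℕ, 1 ≤ m → besselJ 1 ((4 * Real.pi * √(m * (n + θ) * x) : ℝ) : ℂ) /
        ((√(m * (n + θ)) : ℝ) : ℂ) =
        ((2 * Real.pi * √x * cliffordC 1 (4 * Real.pi * Y * (m : ℝ)) : ℝ) : ℂ) := by
      intro m hm
      have hm0 : (0 : ℝ) < m := by exact_mod_cast hm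
      have hs : 0 < √(m * (n + θ)) := Real.sqrt_pos.mpr (by positivity)
      have h := besselJ_natCast 1 ((4 * Real.pi * √(m * (n + θ) * x) : ℝ) : ℂ)
      rw [Nat.cast_one, pow_one] at h
      have e : ((4 * Real.pi * √(m * (n + θ) * x) : ℝ) : ℂ) ^ 2 / 4 =
          ((4 * Real.pi * Y * m : ℝ) : ℂ) := by
        rw [← Complex.ofReal_pow, mul_pow, Real.sq_sqrt (by positivity), hY]
        push_cast
        ring
      rw [h, e, cliffordC.ofReal, Real.sqrt_mul (by positivity)]
      have hs' : ((√(m * (n + θ)) : ℝ) : ℂ) ≠ 0 := by exact_mod_cast hs.ne'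
      push_cast
      field_simp
      ring
    have hsum : ∀ M : ℕ, ∑ m ∈ Finset.Icc 1 M,
        besselJ 1 ((4 * Real.pi * √(m * (n + θ) * x) : ℝ) : ℂ) / ((√(m * (n + θ)) : ℝ) : ℂ) =
        ((2 * Real.pi * √x * ∑ m ∈ Finset.Icc 1 M, cliffordC 1 (4 * Real.pi * Y * (m : ℝ)) : ℝ) : ℂ) := by
      intro M
      rw [Finset.mul_sum, Complex.ofReal_sum]
      exact Finset.sum_congr rfl fun m hm => hterm m (Finset.mem_Icc.mp hm).1
    simp only [hsum]
    refine (Complex.continuous_ofReal.tendsto _).comp ?_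
    convert l using 2
    rw [hI]
    field_simp
    rw [h2]
    ring
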